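/- For $m\ge 2$ let $\mathcal T_m$ be the rooted $m$-regular tree whose vertices are the finite words over an alphabet of $m$ letters, and let $\mathcal A_m$ be its automorphism group. For $\alpha\in\mathcal A_m$ and a vertex $u$, the state $\alpha_u\in\mathcal A_m$ is the automorphism determined by $\alpha(uw)=\alpha(u)\,\alpha_u(w)$ for all words $w$. An automorphism $\alpha$ is *finite-state* if its set of states $Q(\alpha)=\{\alpha_u\}$ is finite, and a subgroup $H\le\mathcal A_m$ is *self-similar* if $Q(\alpha)\subseteq H$ for every $\alpha\in H$. A group is called *finite-state* if, for some $m\ge 2$, it is isomorphic to a subgroup of $\mathcal A_m$ consisting of finite-state automorphisms (i.e. it has a faithful finite-state representation), and it is called *self-similar finite-state* if this subgroup can moreover be chosen self-similar. For an abelian group $A$ and a group $G$, $A\wr G=A^{(G)}\rtimes G$ denotes the restricted regular wreath product. Put $W_1(\mathbb Z)=\mathbb Z$ and $W_k(\mathbb Z)=\mathbb Z\wr W_{k-1}(\mathbb Z)$ for $k>1$. **Theorem C.** 1. Let $A$ be a finitely generated abelian group and let $G$ be a self-similar finite-state group that is not a torsion group. Then $A\wr G$ is finite-state. 2. Let $G$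 be a self-similar finite-state group. Then $\mathbb Z\wr G$ is finite-state. 3. The group $W_k(\mathbb Z)$ is finite-state for every $k\ge 1$. 4. The group $C_2\wr(\mathbb Z\wr\mathbb Z)$ is finite-state. -/

import Mathlib

/-! ### Automorphisms of the rooted regular tree and their states -/

/-- The automorphism group of the rooted tree whose vertices are the finite words over the
alphabet `X` (the root is the empty word, and `u` lies above `v` when `u` is a prefix of `v`):
the permutations of the words that preserve levels and the prefix order.
`TreeAut (Fin m)` is the automorphism group of the `m`-regular rooted tree. -/
def TreeAut (X : Type*) : Subgroup (Equiv.Perm (List X)) where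
  carrier := {α | (∀ w, (α w).length = w.length) ∧ ∀ u v, α u <+: α v ↔ u <+: v}
  one_mem' := ⟨fun _ => rfl, fun _ _ => Iff.rfl⟩
  mul_mem' := by
    rintro α β ⟨hα, hα'⟩ ⟨hβ, hβ'⟩
    exact ⟨fun w => (hα (β w)).trans (hβ w), fun u v => (hα' (β u) (β v)).trans (hβ' u v)⟩
  inv_mem' := by
    rintro α ⟨hα, hα'⟩
    refine ⟨fun w => ?_, fun u v => ?_⟩
    · have h := hα (α⁻¹ w)
      rw [show α (α⁻¹ w) = w from α.apply_symm_apply w] at h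
      exact h.symm
    · have h := hα' (α⁻¹ u) (α⁻¹ v)
      rw [show α (α⁻¹ u) = u from α.apply_symm_apply u,
        show α (α⁻¹ v) = v from α.apply_symm_apply v] at h
      exact h.symm

namespace TreeAut

variable {X : Type*}

theorem length_apply (α : TreeAut X) (w : List X) : (α.1 w).length = w.length := α.2.1 w

theorem apply_append (α : TreeAut X) (u w : List X) :
    α.1 (u ++ w) = α.1 u ++ (α.1 (u ++ w)).drop u.length := by
  obtain ⟨t, ht⟩ := (α.2.2 u (u ++ w)).2 (List.prefix_append u w)
  rw [← ht, ← length_apply α u, List.drop_left]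

/-- The state `α_u` of the tree automorphism `α` at the vertex `u`. It is characterised by
`α (u w) = α (u) α_u (w)` for all words `w`, see `apply_append_state`. -/
def state (α : TreeAut X) (u : List X) : TreeAut X :=
  ⟨{ toFun := fun w => (α.1 (u ++ w)).drop u.length
     invFun := fun w => ((α⁻¹).1 (α.1 u ++ w)).drop u.length
     left_inv := by
       intro w
       have h : (α⁻¹).1 (α.1 (u ++ w)) = u ++ w := α.1.symm_apply_apply (u ++ w)
       simp only [← apply_append α u w, h, List.drop_left]
     right_inv := by
       intro w
       have h := apply_append α⁻¹ (α.1 u) w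
       have h1 : (α⁻¹).1 (α.1 u) = u := α.1.symm_apply_apply u
       rw [h1, length_apply α u] at h
       have h2 : α.1 ((α⁻¹).1 (α.1 u ++ w)) = α.1 u ++ w :=
         α.1.apply_symm_apply (α.1 u ++ w)
       simp only [← h, h2]
       rw [← length_apply α u, List.drop_left] },
   by
     refine ⟨fun w => ?_, fun v w => ?_⟩
     · simp [length_apply]
     · have h := α.2.2 (u ++ v) (u ++ w)
       rw [apply_append α u v, apply_append α u w, List.prefix_append_right_inj,
         List.prefix_append_right_inj] at h
       exact h⟩

theorem apply_append_state (α : TreeAut X) (u w : List X) :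
    α.1 (u ++ w) = α.1 u ++ (state α u).1 w :=
  apply_append α u w

/-- A tree automorphism is finite-state if its set of states `Q(α) = {α_u}` is finite. -/
def IsFiniteState (α : TreeAut X) : Prop :=
  (Set.range (state α)).Finite

/-- A group of tree automorphisms is self-similar (state-closed) if it contains all states of
its elements. -/
def IsSelfSimilar (H : Subgroup (TreeAut X)) : Prop :=
  ∀ α ∈ H, ∀ u : List X, state α u ∈ H

end TreeAut

/-- `G` is finite-state: it has a faithful finite-state representation, that is, it is isomorphic
to a group of finite-state automorphisms of an `m`-regular rooted tree for some `m ≥ 2`. -/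
def HasFiniteStateRep (G : Type*) [Group G] : Prop :=
  ∃ m : ℕ, 2 ≤ m ∧ ∃ φ : G →* TreeAut (Fin m),
    Function.Injective φ ∧ ∀ g, TreeAut.IsFiniteState (φ g)

/-- `G` is a self-similar finite-state group: for some `m ≥ 2`, it is isomorphic to a self-similar
group of finite-state automorphisms of the `m`-regular rooted tree. -/
def HasSelfSimilarFiniteStateRep (G : Type*) [Group G] : Prop :=
  ∃ m : ℕ, 2 ≤ m ∧ ∃ φ : G →* TreeAut (Fin m),
    Function.Injective φ ∧ TreeAut.IsSelfSimilar φ.range ∧ ∀ g, TreeAut.IsFiniteState (φ g)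

/-! ### Restricted wreath products -/

/-- `G` acts on the finitely supported functions `G → A` by `(g • f) x = f (g⁻¹ * x)`. -/
noncomputable def lampAction (A G : Type*) [AddCommGroup A] [Group G] :
    G →* MulAut (Multiplicative (G →₀ A)) where
  toFun g := AddEquiv.toMultiplicative (Finsupp.domCongr (Equiv.mulLeft g))
  map_one' := by
    ext f x
    simp [Finsupp.domCongr]
    rfl
  map_mul' g h := by
    ext f x
    simp [Finsupp.domCongr]
    rfl

/-- The restricted (regular) wreath product `A ≀ G` of an abelian group `A`, written additively,
by a group `G`: the semidirect product `A^(G) ⋊ G`. -/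
abbrev Wreath (A G : Type*) [AddCommGroup A] [Group G] : Type _ :=
  Multiplicative (G →₀ A) ⋊[lampAction A G] G

/-- The iterated wreath products `W_1(ℤ) = ℤ` and `W_k(ℤ) = ℤ ≀ W_{k-1}(ℤ)` for `k > 1`
(at `k = 0`, where there is no such group, the value is the trivial group). -/
noncomputable def iterWreath : ℕ → GrpCat.{0}
  | 0 => GrpCat.of Unit
  | 1 => GrpCat.of (Multiplicative ℤ)
  | k + 2 => GrpCat.of (Wreath ℤ (iterWreath (k + 1)))

/-! ### Self-similar actions -/

/-! Everything follows from one statement (`HasFiniteStateRep.wreath`): if `G` is finite-state and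
`A` is finitely generated abelian, then `A ≀ G` is finite-state.

Let `H` act on words over `X`, and `A` on words over `Z`. In `SelfSimilarAction.wreath` a word of
pairs spelling `(u, v)` filters the lamps: the lamp at `h` survives exactly when `h v = u`. The sum
of the survivors then acts on the letters of `Z` that follow. A lamp at `1` either stays as it is,
vanishes, or passes to a state of its value, so it has finitely many states; a lamp at `h` is a
conjugate of one at `1`, and finite-state elements form a subgroup.

Such an action is faithful if each finite support is separated by a single word `v`: reading `(h v,
v)` isolates the lamp at `h`. An arbitrary faithful action of `G` need not have such words, because
a word moved by one element may leave a useless section for the next test. The action `restart`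
cures this: a separator letter restores the original element, so test words can be concatenated
(`exists_restart_word_ne`). The price is to remember that element, hence the pairs in `Q × Q`.

For `A`, embedded in `ℤ ^ n × B` with `B` finite, the binary odometer serves. -/

/-- A self-similar action of a group `Q` on the words over `Y`, given by the action on letters and
the sections at letters, subject to the cocycle rule. It need not be faithful. -/
structure SelfSimilarAction (Q Y : Type*) [Group Q] where
  /-- The action on letters. -/
  act : Q →* Equiv.Perm Y
  /-- The section of a group element at a letter. -/
  sec : Q → Y → Q
  sec_mul : ∀ g h y, sec (g * h) y = sec g (act h y) * sec h y

namespace SelfSimilarAction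

variable {Q Y : Type*} [Group Q] (S : SelfSimilarAction Q Y)

@[simp]
theorem sec_one (y : Y) : S.sec 1 y = 1 := by
  have h := S.sec_mul 1 1 y
  simpa using h

/-- The action on words. -/
def word : Q → List Y → List Y
  | _, [] => []
  | g, y :: w => S.act g y :: word (S.sec g y) w

/-- The section of a group element at a word. -/
def secs : Q → List Y → Q
  | g, [] => g
  | g, y :: w => secs (S.sec g y) w

@[simp] theorem word_nil (g : Q) : S.word g [] = [] := rfl

@[simp] theorem word_cons (g : Q) (y : Y) (w : List Y) :
    S.word g (y :: w) = S.act g y :: S.word (S.sec g y) w := rfl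

@[simp] theorem secs_nil (g : Q) : S.secs g [] = g := rfl

@[simp] theorem secs_cons (g : Q) (y : Y) (w : List Y) :
    S.secs g (y :: w) = S.secs (S.sec g y) w := rfl

@[simp]
theorem word_one (w : List Y) : S.word 1 w = w := by
  induction w with
  | nil => rfl
  | cons y w ih => simp [ih]

theorem word_mul (g h : Q) (w : List Y) : S.word (g * h) w = S.word g (S.word h w) := by
  induction w generalizing g h with
  | nil => rfl
  | cons y w ih => simp [S.sec_mul, ih]

@[simp]
theorem length_word (g : Q) (w : List Y) : (S.word g w).length = w.length := by
  induction w generalizing g with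
  | nil => rfl
  | cons y w ih => simp [ih]

theorem word_append (g : Q) (u w : List Y) :
    S.word g (u ++ w) = S.word g u ++ S.word (S.secs g u) w := by
  induction u generalizing g with
  | nil => rfl
  | cons y u ih => simp [ih]

theorem secs_append (g : Q) (u w : List Y) :
    S.secs g (u ++ w) = S.secs (S.secs g u) w := by
  induction u generalizing g with
  | nil => rfl
  | cons y u ih => simp [ih]

theorem word_eq_of_append {g : Q} {u w : List Y} (h : S.word g (u ++ w) = u ++ w) :
    S.word g u = u ∧ S.word (S.secs g u) w = w := by
  rw [word_append] at h
  exact List.append_inj h (S.length_word g u)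

@[simp]
theorem secs_one (w : List Y) : S.secs 1 w = 1 := by
  induction w with
  | nil => rfl
  | cons y w ih => simp [ih]

theorem secs_mul (g h : Q) (w : List Y) :
    S.secs (g * h) w = S.secs g (S.word h w) * S.secs h w := by
  induction w generalizing g h with
  | nil => rfl
  | cons y w ih => simp [S.sec_mul, ih]

theorem isPrefix_word (g : Q) {u v : List Y} (h : u <+: v) : S.word g u <+: S.word g v := by
  obtain ⟨t, rfl⟩ := h
  exact ⟨_, (S.word_append g u t).symm⟩

@[simp]
theorem word_inv_word (g : Q) (w : List Y) : S.word g⁻¹ (S.word g w) = w := by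
  rw [← word_mul, inv_mul_cancel, word_one]

@[simp]
theorem word_word_inv (g : Q) (w : List Y) : S.word g (S.word g⁻¹ w) = w := by
  rw [← word_mul, mul_inv_cancel, word_one]

/-- The representation by tree automorphisms defined by a self-similar action. -/
def toTreeAut : Q →* TreeAut Y where
  toFun g := ⟨⟨S.word g, S.word g⁻¹, S.word_inv_word g, S.word_word_inv g⟩,
    S.length_word g, fun u v => ⟨fun h => by
      have h' := S.isPrefix_word g⁻¹ h
      exact (S.word_inv_word g u) ▸ (S.word_inv_word g v) ▸ h', S.isPrefix_word g⟩⟩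
  map_one' := Subtype.ext (Equiv.ext S.word_one)
  map_mul' g h := Subtype.ext (Equiv.ext (S.word_mul g h))

theorem toTreeAut_apply (g : Q) (w : List Y) : (S.toTreeAut g).1 w = S.word g w := rfl

theorem state_toTreeAut (g : Q) (u : List Y) :
    TreeAut.state (S.toTreeAut g) u = S.toTreeAut (S.secs g u) := by
  refine Subtype.ext (Equiv.ext fun w => ?_)
  have h := TreeAut.apply_append_state (S.toTreeAut g) u w
  simp only [toTreeAut_apply, word_append] at h
  exact (List.append_cancel_left h).symm

/-- The group elements with finitely many sections. -/
def finiteState : Subgroup Q where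
  carrier := {g | (Set.range (S.secs g)).Finite}
  one_mem' := (Set.finite_singleton (1 : Q)).subset (by rintro _ ⟨u, rfl⟩; simp)
  mul_mem' {g h} hg hh := (Set.Finite.image2 (· * ·) hg hh).subset (by
    rintro _ ⟨u, rfl⟩
    exact ⟨_, ⟨_, rfl⟩, _, ⟨_, rfl⟩, (S.secs_mul g h u).symm⟩)
  inv_mem' {g} hg := (Set.Finite.image (·⁻¹) hg).subset (by
    rintro _ ⟨u, rfl⟩
    refine ⟨S.secs g (S.word g⁻¹ u), ⟨_, rfl⟩, ?_⟩
    rw [inv_eq_iff_mul_eq_one, ← secs_mul, mul_inv_cancel, secs_one])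

theorem mem_finiteState {g : Q} : g ∈ S.finiteState ↔ (Set.range (S.secs g)).Finite := Iff.rfl

/-- Sections at words are iterated sections at letters, so a finite set closed under the latter
traps all states. -/
theorem mem_finiteState_of_closed {s : Set Q} (hs : s.Finite)
    (h : ∀ g ∈ s, ∀ y, S.sec g y ∈ s) {g : Q} (hg : g ∈ s) : g ∈ S.finiteState := by
  refine hs.subset ?_
  rintro _ ⟨u, rfl⟩
  induction u generalizing g with
  | nil => exact hg
  | cons y u ih => exact ih (h g hg y)

theorem sec_mem_range_secs {g k : Q} (hk : k ∈ Set.range (S.secs g)) (y : Y) :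
    S.sec k y ∈ Set.range (S.secs g) := by
  obtain ⟨u, rfl⟩ := hk
  exact ⟨u ++ [y], by simp [secs_append]⟩

/-- Renaming of the letters of a self-similar action. -/
def mapAlphabet {Z : Type*} (e : Y ≃ Z) : SelfSimilarAction Q Z where
  act := (Equiv.permCongrHom e : Equiv.Perm Y ≃* Equiv.Perm Z).toMonoidHom.comp S.act
  sec g z := S.sec g (e.symm z)
  sec_mul g h z := by simp [S.sec_mul, Equiv.permCongrHom]

theorem word_mapAlphabet {Z : Type*} (e : Y ≃ Z) (g : Q) (w : List Y) :
    (S.mapAlphabet e).word g (w.map e) = (S.word g w).map e := by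
  induction w generalizing g with
  | nil => rfl
  | cons y w ih =>
    have h : (S.mapAlphabet e).sec g (e y) = S.sec g y := by simp [mapAlphabet]
    simp [ih, h]
    simp [mapAlphabet, Equiv.permCongrHom]

theorem secs_mapAlphabet {Z : Type*} (e : Y ≃ Z) (g : Q) (w : List Z) :
    (S.mapAlphabet e).secs g w = S.secs g (w.map e.symm) := by
  induction w generalizing g with
  | nil => rfl
  | cons z w ih => exact ih (S.sec g (e.symm z))

/-- A group that maps to the finite-state part of a self-similar action on a finite alphabet, with
faithful induced action on words, is finite-state. -/
theorem hasFiniteStateRep [Finite Y] [Nontrivial Y] {G : Type*} [Group G] (f : G →* Q)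
    (hf : ∀ g, f g ∈ S.finiteState) (hinj : ∀ g, (∀ w, S.word (f g) w = w) → g = 1) :
    HasFiniteStateRep G := by
  obtain ⟨m, ⟨e⟩⟩ := Finite.exists_equiv_fin Y
  refine ⟨m, ?_, (S.mapAlphabet e).toTreeAut.comp f, ?_, fun g => ?_⟩
  · have h := Finite.one_lt_card (α := Y)
    rwa [Nat.card_congr e, Nat.card_fin] at h
  · rw [injective_iff_map_eq_one]
    refine fun g hg => hinj g fun w => ?_
    have h : (S.mapAlphabet e).word (f g) (w.map e) = w.map e :=
      congrArg (fun α : TreeAut (Fin m) => α.1 (w.map e)) hg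
    rw [word_mapAlphabet] at h
    exact (List.map_injective_iff.2 e.injective) h
  · refine ((hf g).image (S.mapAlphabet e).toTreeAut).subset ?_
    rintro _ ⟨u, rfl⟩
    refine ⟨S.secs (f g) (u.map e.symm), ⟨_, rfl⟩, ?_⟩
    rw [MonoidHom.comp_apply, state_toTreeAut, secs_mapAlphabet]

end SelfSimilarAction

/-! ### The full automorphism group of the tree -/

namespace TreeAut

variable {X : Type*}

theorem state_mul (α β : TreeAut X) (u : List X) :
    state (α * β) u = state α (β.1 u) * state β u := by
  refine Subtype.ext (Equiv.ext fun w => ?_)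
  have h := apply_append_state (α * β) u w
  have h' : (α * β).1 (u ++ w) = α.1 (β.1 u) ++ (state α (β.1 u)).1 ((state β u).1 w) := by
    change α.1 (β.1 (u ++ w)) = _
    rw [apply_append_state β, apply_append_state α]
  rw [h'] at h
  exact (List.append_cancel_left h).symm

theorem state_state (α : TreeAut X) (u v : List X) :
    state (state α u) v = state α (u ++ v) := by
  refine Subtype.ext (Equiv.ext fun w => ?_)
  have h := apply_append_state α (u ++ v) w
  rw [List.append_assoc, apply_append_state α u, apply_append_state (state α u) v,
    apply_append_state α u v, List.append_assoc] at h
  exact List.append_cancel_left (List.append_cancel_left h)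

theorem state_nil (α : TreeAut X) : state α [] = α := by
  refine Subtype.ext (Equiv.ext fun w => ?_)
  simp [state]

/-- The action of a tree automorphism on the first level. -/
def letter (α : TreeAut X) (x : X) : X :=
  (α.1 [x]).head (List.ne_nil_of_length_pos (by simp [length_apply]))

theorem apply_singleton (α : TreeAut X) (x : X) : α.1 [x] = [letter α x] := by
  obtain ⟨y, hy⟩ := List.length_eq_one_iff.1 (length_apply α [x])
  simp [letter, hy]

theorem letter_mul (α β : TreeAut X) (x : X) : letter (α * β) x = letter α (letter β x) := by
  have h : (α * β).1 [x] = α.1 (β.1 [x]) := rfl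
  rw [apply_singleton β, apply_singleton α, apply_singleton] at h
  exact List.singleton_injective h

theorem letter_one (x : X) : letter (1 : TreeAut X) x = x := rfl

/-- The tautological self-similar action of the full automorphism group of the tree. -/
def selfSimilarAction (X : Type*) : SelfSimilarAction (TreeAut X) X where
  act :=
    { toFun := fun α => ⟨letter α, letter α⁻¹,
        fun x => by rw [← letter_mul, inv_mul_cancel, letter_one],
        fun x => by rw [← letter_mul, mul_inv_cancel, letter_one]⟩
      map_one' := Equiv.ext letter_one
      map_mul' := fun α β => Equiv.ext (letter_mul α β) }
  sec α x := state α [x]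
  sec_mul α β x := by
    rw [state_mul, apply_singleton]
    rfl

theorem word_selfSimilarAction (α : TreeAut X) (w : List X) :
    (selfSimilarAction X).word α w = α.1 w := by
  induction w generalizing α with
  | nil => exact (List.length_eq_zero_iff.1 (length_apply α [])).symm
  | cons x w ih =>
    have h := apply_append_state α [x] w
    rw [apply_singleton] at h
    rw [SelfSimilarAction.word_cons, ih]
    exact h.symm

theorem secs_selfSimilarAction (α : TreeAut X) (w : List X) :
    (selfSimilarAction X).secs α w = state α w := by
  induction w generalizing α with
  | nil => exact (state_nil α).symm
  | cons x w ih =>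
    rw [SelfSimilarAction.secs_cons, ih]
    exact state_state α [x] w

end TreeAut

/-! ### Actions with restarts -/

namespace SelfSimilarAction

variable {Q X : Type*} [Group Q] (S : SelfSimilarAction Q X)

/-- The self-similar action on words with a separator `none`: the pair `(b, c)` acts by `c` on the
letters before the first separator, and by `b` on each of the blocks after it. -/
def restart : SelfSimilarAction (Q × Q) (Option X) where
  act :=
    { toFun := fun q => Equiv.optionCongr (S.act q.2)
      map_one' := by ext1 x; cases x <;> simp
      map_mul' := fun p q => by ext1 x; cases x <;> simp }
  sec
    | q, none => (q.1, q.1)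
    | q, some x => (q.1, S.sec q.2 x)
  sec_mul g h x := by cases x <;> simp [S.sec_mul]

@[simp] theorem restart_act (q : Q × Q) (x : Option X) : S.restart.act q x = x.map (S.act q.2) :=
  rfl

@[simp] theorem restart_sec_none (q : Q × Q) : S.restart.sec q none = (q.1, q.1) := rfl

@[simp] theorem restart_sec_some (q : Q × Q) (x : X) :
    S.restart.sec q (some x) = (q.1, S.sec q.2 x) := rfl

theorem word_restart_map_some (q : Q × Q) (w : List X) :
    S.restart.word q (w.map some) = (S.word q.2 w).map some := by
  induction w generalizing q with
  | nil => rfl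
  | cons x w ih => simp [ih]

theorem secs_restart_fst (q : Q × Q) (w : List (Option X)) : (S.restart.secs q w).1 = q.1 := by
  induction w generalizing q with
  | nil => rfl
  | cons x w ih => cases x <;> simp [ih]

/-- The remembered coordinate never changes, and the other one runs through states of `g`; a reset
returns it to `g`, the state at the empty word. -/
theorem restart_mem_finiteState {g : Q} (hg : g ∈ S.finiteState) :
    (g, g) ∈ S.restart.finiteState := by
  have hself : g ∈ Set.range (S.secs g) := ⟨[], rfl⟩
  refine S.restart.mem_finiteState_of_closed (s := {g} ×ˢ Set.range (S.secs g))
    ((Set.finite_singleton g).prod hg) ?_ ⟨rfl, hself⟩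
  rintro ⟨b, c⟩ ⟨hb, hc⟩ x
  cases x with
  | none =>
    cases hb
    exact ⟨rfl, hself⟩
  | some x => exact ⟨hb, S.sec_mem_range_secs hc x⟩

/-- Finitely many elements acting nontrivially move a common word of the action with restarts. -/
theorem exists_restart_word_ne (s : Finset Q) (hs : ∀ g ∈ s, ∃ w, S.word g w ≠ w) :
    ∃ v, ∀ g ∈ s, S.restart.word (g, g) v ≠ v := by
  classical
  induction s using Finset.induction_on with
  | empty => exact ⟨[], by simp⟩
  | insert g s _ ih =>
    obtain ⟨v, hv⟩ := ih fun k hk => hs k (Finset.mem_insert_of_mem hk)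
    obtain ⟨w, hw⟩ := hs g (Finset.mem_insert_self g s)
    -- The prefix `v` handles the elements of `s`; after the separator `g` starts afresh on `w`,
    -- whatever its section at `v` was.
    refine ⟨v ++ none :: w.map some, fun k hk h => ?_⟩
    obtain ⟨h₁, h₂⟩ := S.restart.word_eq_of_append h
    rcases Finset.mem_insert.1 hk with rfl | hk
    · simp only [word_cons, restart_sec_none, secs_restart_fst, word_restart_map_some,
        List.cons.injEq] at h₂
      exact hw (List.map_injective_iff.2 (Option.some_injective X) h₂.2)
    · exact hv k hk h₁

end SelfSimilarAction

/-! ### The self-similar action of a wreath product -/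

section Lamps

/-- The sum of all lamps. -/
noncomputable def lampTotal {A H : Type*} [AddCommGroup A] : (H →₀ A) →+ A :=
  Finsupp.liftAddHom fun _ => AddMonoidHom.id A

@[simp]
theorem lampTotal_single {A H : Type*} [AddCommGroup A] (h : H) (a : A) :
    lampTotal (Finsupp.single h a) = a := by
  simp [lampTotal]

variable {A H : Type*} [AddCommGroup A] [Group H]

/-- The translation of lamp configurations by a group element. -/
noncomputable def lampShift (g : H) : (H →₀ A) →+ (H →₀ A) :=
  (Finsupp.domCongr (Equiv.mulLeft g)).toAddMonoidHom

@[simp]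
theorem lampShift_single (g h : H) (a : A) :
    lampShift g (Finsupp.single h a) = Finsupp.single (g * h) a := by
  simp [lampShift, Finsupp.domCongr]

theorem toAdd_lampAction (g : H) (f : Multiplicative (H →₀ A)) :
    (lampAction A H g f).toAdd = lampShift g f.toAdd := rfl

@[simp]
theorem lampTotal_shift (g : H) (f : H →₀ A) : lampTotal (lampShift g f) = lampTotal f := by
  have h : lampTotal.comp (lampShift g) = (lampTotal : (H →₀ A) →+ A) := by
    ext; simp
  exact DFunLike.congr_fun h f

end Lamps

namespace SelfSimilarAction

variable {A H X Z : Type*} [AddCommGroup A] [Group H]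
  (S : SelfSimilarAction H X) (T : SelfSimilarAction (Multiplicative A) Z)

open Classical in
/-- The lamp configuration obtained by keeping the lamps at those `h` that map `y` to `x`, and
moving them to the sections of `h` at `y`. -/
noncomputable def lampDeriv (x y : X) : (H →₀ A) →+ (H →₀ A) :=
  Finsupp.liftAddHom fun h =>
    if S.act h y = x then Finsupp.singleAddHom (S.sec h y) else 0

open Classical in
@[simp]
theorem lampDeriv_single (x y : X) (h : H) (a : A) :
    S.lampDeriv x y (Finsupp.single h a) =
      if S.act h y = x then Finsupp.single (S.sec h y) a else 0 := by
  simp only [lampDeriv, Finsupp.liftAddHom_apply_single]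
  split_ifs <;> simp

/-- This is the cocycle rule for the lamps: `g h` maps `y` to `g x` exactly when `h` maps `y` to
`x`, and then its section at `y` is that of `g` at `x` times that of `h` at `y`. -/
theorem lampDeriv_shift (g : H) (x y : X) (f : H →₀ A) :
    S.lampDeriv (S.act g x) y (lampShift g f) = lampShift (S.sec g x) (S.lampDeriv x y f) := by
  have h : (S.lampDeriv (S.act g x) y).comp (lampShift g) =
      (lampShift (S.sec g x)).comp (S.lampDeriv (A := A) x y) := by
    refine Finsupp.addHom_ext fun h a => ?_
    by_cases hx : S.act h y = x
    · simp [hx, S.sec_mul]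
    · simp [hx]
  exact DFunLike.congr_fun h f

/-- The self-similar action of `A ≀ H` on words in the letters `(x, y)` and `z`, derived from
self-similar actions of `H` and `A`. The group `H` acts on the letters `x` up to the first letter
from `Z`; the lamp at `h` acts on the letters `z` as long as `h` maps the word of the preceding
letters `y` to that of the letters `x`. -/
noncomputable def wreath : SelfSimilarAction (Wreath A H) ((X × X) ⊕ Z) where
  act :=
    { toFun := fun q => Equiv.sumCongr (Equiv.prodCongr (S.act q.right) (Equiv.refl X))
        (T.act (.ofAdd (lampTotal q.left.toAdd)))
      map_one' := by ext1 p; rcases p with ⟨x, y⟩ | z <;> simp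
      map_mul' := fun p q => by
        ext1 l
        rcases l with ⟨x, y⟩ | z <;> simp [toAdd_lampAction] }
  sec
    -- Since `q` is `left * right`, the lamps act after `q.right` and are compared with the letter
    -- it has already moved.
    | q, .inl (x, y) => ⟨.ofAdd (S.lampDeriv (S.act q.right x) y q.left.toAdd), S.sec q.right x⟩
    -- From here on only the lamp total matters, so it is stored as one lamp at `1`.
    | q, .inr z => .inl (.ofAdd (.single 1 (T.sec (.ofAdd (lampTotal q.left.toAdd)) z).toAdd))
  sec_mul g h l := by
    rcases l with ⟨x, y⟩ | z
    · refine SemidirectProduct.ext (Multiplicative.toAdd.injective ?_) ?_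
      · simp [toAdd_lampAction, S.lampDeriv_shift]
      · simp [S.sec_mul]
    · simp only [SemidirectProduct.mul_left, toAdd_mul, toAdd_lampAction, map_add,
        lampTotal_shift, ofAdd_add, T.sec_mul, Finsupp.single_add, map_mul]
      rfl

@[simp] theorem wreath_act_inl (q : Wreath A H) (x y : X) :
    (S.wreath T).act q (.inl (x, y)) = .inl (S.act q.right x, y) := rfl

@[simp] theorem wreath_act_inr (q : Wreath A H) (z : Z) :
    (S.wreath T).act q (.inr z) = .inr (T.act (.ofAdd (lampTotal q.left.toAdd)) z) := rfl

@[simp] theorem wreath_sec_inl (q : Wreath A H) (x y : X) :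
    (S.wreath T).sec q (.inl (x, y)) =
      ⟨.ofAdd (S.lampDeriv (S.act q.right x) y q.left.toAdd), S.sec q.right x⟩ := rfl

@[simp] theorem wreath_sec_inr (q : Wreath A H) (z : Z) :
    (S.wreath T).sec q (.inr z) =
      .inl (.ofAdd (.single 1 (T.sec (.ofAdd (lampTotal q.left.toAdd)) z).toAdd)) := rfl

/-! ### Finiteness of the states in the wreath action -/

theorem wreath_inr_mem_finiteState {h : H} (hh : h ∈ S.finiteState) :
    (SemidirectProduct.inr h : Wreath A H) ∈ (S.wreath T).finiteState := by
  refine (S.wreath T).mem_finiteState_of_closed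
    (s := insert 1 (SemidirectProduct.inr '' Set.range (S.secs h)))
    ((hh.image _).insert 1) ?_ (Or.inr ⟨h, ⟨[], rfl⟩, rfl⟩)
  rintro _ (rfl | ⟨k, hk, rfl⟩) l
  · left; simp
  · rcases l with ⟨x, y⟩ | z
    · refine Or.inr ⟨_, S.sec_mem_range_secs hk x, ?_⟩
      ext <;> simp
    · left; simp

/-- The identity has trivial sections, so a lamp at `1` survives unchanged at `(x, x)` and dies at
`(x, y)` with `x ≠ y`; only letters of `Z` alter its value. -/
theorem wreath_single_one_mem_finiteState {a : A} (ha : .ofAdd a ∈ T.finiteState) :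
    (SemidirectProduct.inl (.ofAdd (Finsupp.single 1 a)) : Wreath A H) ∈
      (S.wreath T).finiteState := by
  refine (S.wreath T).mem_finiteState_of_closed
    (s := insert 1 ((fun b : Multiplicative A =>
      SemidirectProduct.inl (.ofAdd (Finsupp.single 1 b.toAdd))) '' Set.range (T.secs (.ofAdd a))))
    ((ha.image _).insert 1) ?_ (Or.inr ⟨_, ⟨[], rfl⟩, rfl⟩)
  rintro _ (rfl | ⟨k, hk, rfl⟩) l
  · left; simp
  · rcases l with ⟨x, y⟩ | z
    · by_cases hxy : y = x
      · refine Or.inr ⟨k, hk, ?_⟩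
        refine SemidirectProduct.ext ?_ ?_ <;> simp [hxy]
      · refine Or.inl ?_
        refine SemidirectProduct.ext ?_ ?_ <;> simp [hxy]
    · exact Or.inr ⟨_, T.sec_mem_range_secs hk z, by simp⟩

/-- Conjugating a lamp at `1` by `h` moves it to `h`. -/
theorem wreath_single_mem_finiteState {h : H} (hh : h ∈ S.finiteState) {a : A}
    (ha : .ofAdd a ∈ T.finiteState) :
    (SemidirectProduct.inl (.ofAdd (Finsupp.single h a)) : Wreath A H) ∈
      (S.wreath T).finiteState := by
  have hr := S.wreath_inr_mem_finiteState T hh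
  have hl := S.wreath_single_one_mem_finiteState T ha
  have h' := mul_mem (mul_mem hr hl) (inv_mem hr)
  have e : lampAction A H h (.ofAdd (Finsupp.single 1 a)) = .ofAdd (Finsupp.single h a) := by
    refine Multiplicative.toAdd.injective ?_
    simp [toAdd_lampAction]
  rwa [← map_inv, ← SemidirectProduct.inl_aut, e] at h'

theorem wreath_mem_finiteState {q : Wreath A H} (hr : q.right ∈ S.finiteState)
    (hl : ∀ h ∈ q.left.toAdd.support, h ∈ S.finiteState) (hT : ∀ a, a ∈ T.finiteState) :
    q ∈ (S.wreath T).finiteState := by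
  rw [← SemidirectProduct.inl_left_mul_inr_right q]
  refine mul_mem ?_ (S.wreath_inr_mem_finiteState T hr)
  have e : q.left = ∏ h ∈ q.left.toAdd.support,
      Multiplicative.ofAdd (Finsupp.single h (q.left.toAdd h)) := by
    conv_lhs => rw [← ofAdd_toAdd q.left, ← Finsupp.sum_single q.left.toAdd]
    rw [Finsupp.sum, ofAdd_sum]
  change q.left ∈ (S.wreath T).finiteState.comap SemidirectProduct.inl
  rw [e]
  exact prod_mem fun h hh => S.wreath_single_mem_finiteState T (hl h hh) (hT _)

/-! ### Faithfulness of the wreath action -/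

theorem word_wreath_inr (q : Wreath A H) (w : List Z) :
    (S.wreath T).word q (w.map .inr) =
      (T.word (.ofAdd (lampTotal q.left.toAdd)) w).map .inr := by
  induction w generalizing q with
  | nil => rfl
  | cons z w ih => simp [ih]

theorem word_wreath_inl (q : Wreath A H) (w : List X) :
    (S.wreath T).word q (w.map fun x => .inl (x, x)) =
      (List.zip (S.word q.right w) w).map .inl := by
  induction w generalizing q with
  | nil => rfl
  | cons x w ih => simp [ih]

open Classical in
/-- The sum of the lamps that map the word `v` to the word `u`. -/
noncomputable def lampCount (u v : List X) : (H →₀ A) →+ A :=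
  Finsupp.liftAddHom fun h => if S.word h v = u then AddMonoidHom.id A else 0

/-- `h` maps `y :: v` to `x :: u` exactly when it maps `y` to `x` and its section at `y` maps `v` to
`u`. -/
theorem lampCount_cons (x y : X) (u v : List X) (f : H →₀ A) :
    S.lampCount u v (S.lampDeriv x y f) = S.lampCount (x :: u) (y :: v) f := by
  classical
  have h : (S.lampCount u v).comp (S.lampDeriv x y) =
      S.lampCount (A := A) (x :: u) (y :: v) := by
    refine Finsupp.addHom_ext fun h a => ?_
    by_cases hx : S.act h y = x <;> simp [lampCount, hx]
  exact DFunLike.congr_fun h f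

theorem lampCount_nil (f : H →₀ A) : S.lampCount [] [] f = lampTotal f := by
  simp [lampCount, lampTotal]

theorem lampTotal_secs_wreath (f : H →₀ A) {u v : List X} (h : u.length = v.length) :
    lampTotal ((S.wreath T).secs (.inl (.ofAdd f)) ((List.zip u v).map .inl)).left.toAdd =
      S.lampCount u v f := by
  induction v generalizing u f with
  | nil =>
    obtain rfl := List.length_eq_zero_iff.1 h
    simp [lampCount_nil]
  | cons y v ih =>
    obtain ⟨x, u, rfl⟩ := List.exists_cons_of_length_eq_add_one h
    have e : (S.wreath T).sec (.inl (.ofAdd f)) (.inl (x, y)) =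
        .inl (.ofAdd (S.lampDeriv x y f)) := by
      refine SemidirectProduct.ext ?_ ?_ <;> simp
    rw [List.zip_cons_cons, List.map_cons, secs_cons, e, ih _ (by simpa using h), lampCount_cons]

theorem lampCount_eq_apply (f : H →₀ A) {h : H} {v : List X}
    (hv : ∀ k ∈ f.support, S.word k v = S.word h v → k = h) :
    S.lampCount (S.word h v) v f = f h := by
  classical
  rw [lampCount, Finsupp.liftAddHom_apply, Finsupp.sum, Finset.sum_eq_single h]
  · simp
  · intro k hk hkh
    rw [if_neg fun e => hkh (hv k hk e)]
    rfl
  · intro hh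
    simpa using hh

/-- An element of `A ≀ H` that acts trivially on all words is trivial, if `A` acts faithfully and
the elements of `H` that occur in it are separated by their actions on a single word. -/
theorem wreath_faithful (hT : ∀ a, (∀ w, T.word a w = w) → a = 1) {q : Wreath A H}
    (hr : (∀ w, S.word q.right w = w) → q.right = 1)
    (hl : ∃ v, Set.InjOn (fun h => S.word h v) q.left.toAdd.support)
    (hq : ∀ w, (S.wreath T).word q w = w) : q = 1 := by
  have hright : q.right = 1 := hr fun w => by
    -- Pair words show the action of `q.right` in their first coordinates; the second coordinates
    -- are arbitrary here.
    have h := hq (w.map fun x => .inl (x, x))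
    rw [word_wreath_inl] at h
    have h' : (w.map fun x => Sum.inl (x, x) : List ((X × X) ⊕ Z)) = (List.zip w w).map .inl := by
      clear h
      induction w with
      | nil => rfl
      | cons x w ih => simp [ih]
    rw [h'] at h
    have h'' := congrArg (List.map Prod.fst) (List.map_injective_iff.2 Sum.inl_injective h)
    rwa [List.map_fst_zip (by simp), List.map_fst_zip le_rfl] at h''
  obtain ⟨f, g⟩ := q
  obtain rfl : g = 1 := hright
  obtain ⟨v, hv⟩ := hl
  suffices f = 1 by subst this; rfl
  refine Multiplicative.toAdd.injective (Finsupp.ext fun h => ?_)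
  by_contra hne
  have hmem : h ∈ f.toAdd.support := Finsupp.mem_support_iff.2 hne
  refine hne (Multiplicative.ofAdd.injective (hT _ fun w => ?_))
  -- The pairs `(h v, v)` kill every lamp of `f` except the one at `h`, whose value then acts on
  -- `w`.
  obtain ⟨-, h₂⟩ := (S.wreath T).word_eq_of_append
    (hq ((List.zip (S.word h v) v).map .inl ++ w.map .inr))
  have e : (⟨f, 1⟩ : Wreath A H) = .inl (.ofAdd f.toAdd) := rfl
  rw [word_wreath_inr, e, lampTotal_secs_wreath _ _ _ (by simp),
    lampCount_eq_apply _ _ fun k hk hkv => hv hk hmem hkv] at h₂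
  exact List.map_injective_iff.2 Sum.inr_injective h₂

end SelfSimilarAction

/-! ### Finitely generated abelian groups -/

section Odometer

/-- Rewriting the output digit as a remainder turns the cocycle rule for carries into integer
arithmetic. -/
theorem val_intCast_add_zmod_two (n : ℤ) (z : ZMod 2) :
    (((n : ZMod 2) + z).val : ℤ) = (n + z.val) % 2 := by
  have h : (n : ZMod 2) + z = ((n + z.val : ℤ) : ZMod 2) := by simp
  rw [h, ZMod.val_intCast]
  rfl

variable (ι B : Type*) [AddCommGroup B]

/-- The self-similar action of `ℤ ^ ι × B`: coordinatewise addition with carry of the binary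
odometer, and translation by `B` in the first letter. -/
def odometer : SelfSimilarAction (Multiplicative ((ι → ℤ) × B)) ((ι → ZMod 2) × B) where
  act :=
    { toFun := fun a => Equiv.addLeft ((fun i => (a.toAdd.1 i : ZMod 2)), a.toAdd.2)
      map_one' := by ext1 z; ext <;> simp
      map_mul' := fun a b => by ext1 z; ext <;> simp [add_assoc] }
  sec a z := .ofAdd ((fun i => (a.toAdd.1 i + (z.1 i).val) / 2), 0)
  sec_mul a b z := by
    refine Multiplicative.toAdd.injective (Prod.ext (funext fun i => ?_) ?_)
    · change (a.toAdd.1 i + b.toAdd.1 i + ((z.1 i).val : ℤ)) / 2 =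
        (a.toAdd.1 i + (((b.toAdd.1 i : ZMod 2) + z.1 i).val : ℤ)) / 2 +
          (b.toAdd.1 i + ((z.1 i).val : ℤ)) / 2
      rw [val_intCast_add_zmod_two]
      omega
    · simp

theorem odometer_sec (a : Multiplicative ((ι → ℤ) × B)) (z : (ι → ZMod 2) × B) :
    (odometer ι B).sec a z = .ofAdd ((fun i => (a.toAdd.1 i + (z.1 i).val) / 2), 0) := rfl

theorem odometer_act (a : Multiplicative ((ι → ℤ) × B)) (z : (ι → ZMod 2) × B) :
    (odometer ι B).act a z = ((fun i => (a.toAdd.1 i : ZMod 2)), a.toAdd.2) + z := rfl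

theorem mem_finiteState_odometer [Finite ι] [Finite B] (a : Multiplicative ((ι → ℤ) × B)) :
    a ∈ (odometer ι B).finiteState := by
  cases nonempty_fintype ι
  -- `M` bounds all coordinates at once, and `[-M, M]` is stable under `c ↦ ⌊(c + d) / 2⌋` for a
  -- digit `d`.
  let M : ℤ := 1 + ∑ i, |a.toAdd.1 i|
  have hM : 1 ≤ M := by
    have : 0 ≤ ∑ i, |a.toAdd.1 i| := Finset.sum_nonneg fun i _ => abs_nonneg _
    omega
  refine (odometer ι B).mem_finiteState_of_closed
    (s := Multiplicative.toAdd ⁻¹' ((Set.univ.pi fun _ => Set.Icc (-M) M) ×ˢ Set.univ)) ?_ ?_ ?_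
  · exact ((Set.Finite.pi fun _ => Set.finite_Icc _ _).prod Set.finite_univ).preimage
      Multiplicative.toAdd.injective.injOn
  · rintro b ⟨hb, -⟩ z
    refine ⟨fun i _ => ?_, trivial⟩
    have hi := hb i trivial
    have hz : (z.1 i).val < 2 := ZMod.val_lt _
    simp only [Set.mem_Icc, odometer_sec, toAdd_ofAdd] at hi ⊢
    omega
  · refine ⟨fun i _ => ?_, trivial⟩
    have hi : |a.toAdd.1 i| ≤ ∑ i, |a.toAdd.1 i| :=
      Finset.single_le_sum (f := fun i => |a.toAdd.1 i|) (fun i _ => abs_nonneg _)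
        (Finset.mem_univ i)
    rw [Set.mem_Icc, ← abs_le]
    exact hi.trans (le_add_of_nonneg_left zero_le_one)

/-- Fixing the digit `0` forces the coordinate to be even, and the section is then its exact half.
-/
theorem two_pow_dvd_of_odometer_word_eq (k : ℕ) (a : Multiplicative ((ι → ℤ) × B))
    (h : (odometer ι B).word a (List.replicate k 0) = List.replicate k 0) (i : ι) :
    2 ^ k ∣ a.toAdd.1 i := by
  induction k generalizing a with
  | zero => simp
  | succ k ih =>
    rw [List.replicate_succ, SelfSimilarAction.word_cons, List.cons.injEq] at h
    have h₁ : (a.toAdd.1 i : ZMod 2) = 0 := by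
      have := congrArg (fun z => z.1 i) h.1
      simpa [odometer_act] using this
    have h₂ := ih _ h.2
    rw [ZMod.intCast_zmod_eq_zero_iff_dvd] at h₁
    obtain ⟨c, hc⟩ := h₁
    simp only [odometer_sec, toAdd_ofAdd, Prod.fst_zero, Pi.zero_apply, ZMod.val_zero,
      Nat.cast_zero, add_zero, hc, Nat.cast_ofNat] at h₂
    rw [Int.mul_ediv_cancel_left c two_ne_zero] at h₂
    rw [hc, pow_succ']
    exact mul_dvd_mul_left 2 h₂

theorem odometer_faithful (a : Multiplicative ((ι → ℤ) × B))
    (h : ∀ w, (odometer ι B).word a w = w) : a = 1 := by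
  refine Multiplicative.toAdd.injective (Prod.ext (funext fun i => ?_) ?_)
  · refine Int.eq_zero_of_abs_lt_dvd
      (two_pow_dvd_of_odometer_word_eq ι B (a.toAdd.1 i).natAbs a (h _) i) ?_
    rw [Int.abs_eq_natAbs]
    exact_mod_cast Nat.lt_two_pow_self
  · have h₀ := h [0]
    rw [SelfSimilarAction.word_cons, List.cons.injEq, odometer_act] at h₀
    simpa using congrArg Prod.snd h₀.1

end Odometer

-- An embedding is enough, since `A ≀ G` then embeds in the larger wreath product.
open DirectSum in
theorem AddCommGroup.exists_injective_int_pow_prod_finite (A : Type*) [AddCommGroup A]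
    [AddGroup.FG A] : ∃ (n : ℕ) (B : Type) (_ : AddCommGroup B) (_ : Finite B)
      (f : A →+ (Fin n → ℤ) × B), Function.Injective f := by
  obtain ⟨n, ι, _, p, hp, e, ⟨E⟩⟩ := AddCommGroup.equiv_free_prod_directSum_zmod A
  have hfin : ∀ i, NeZero (p i ^ e i) := fun i => ⟨pow_ne_zero _ (hp i).ne_zero⟩
  refine ⟨n, ⨁ i, ZMod (p i ^ e i), inferInstance,
    Finite.of_equiv _ (DirectSum.addEquivProd fun i => ZMod (p i ^ e i)).symm.toEquiv,
    (Finsupp.coeFnAddHom.prodMap (AddMonoidHom.id _)).comp E.toAddMonoidHom, ?_⟩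
  exact (DFunLike.coe_injective.prodMap Function.injective_id).comp E.injective

/-! ### Wreath products of finite-state groups -/

section WreathMap

variable {A B G H : Type*} [AddCommGroup A] [AddCommGroup B] [Group G] [Group H]

/-- The homomorphism of wreath products induced by homomorphisms of the factors. -/
noncomputable def wreathMap (f : A →+ B) (φ : G →* H) : Wreath A G →* Wreath B H :=
  SemidirectProduct.map
    (AddMonoidHom.toMultiplicative
      ((Finsupp.mapDomain.addMonoidHom φ).comp (Finsupp.mapRange.addMonoidHom f))) φ
    (by
      intro g
      have h : ((Finsupp.mapDomain.addMonoidHom φ).comp (Finsupp.mapRange.addMonoidHom f)).comp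
          (lampShift g) = (lampShift (φ g)).comp
          ((Finsupp.mapDomain.addMonoidHom φ).comp (Finsupp.mapRange.addMonoidHom f)) := by
        refine Finsupp.addHom_ext fun k a => ?_
        simp [Finsupp.mapDomain_single]
      exact MonoidHom.ext fun x => congrArg Multiplicative.ofAdd (DFunLike.congr_fun h x.toAdd))

theorem wreathMap_right (f : A →+ B) (φ : G →* H) (q : Wreath A G) :
    (wreathMap f φ q).right = φ q.right := rfl

theorem wreathMap_left (f : A →+ B) (φ : G →* H) (q : Wreath A G) :
    (wreathMap f φ q).left.toAdd =
      Finsupp.mapDomain φ (Finsupp.mapRange f f.map_zero q.left.toAdd) := rfl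

theorem wreathMap_injective {f : A →+ B} (hf : Function.Injective f) {φ : G →* H}
    (hφ : Function.Injective φ) : Function.Injective (wreathMap f φ) := by
  intro p q h
  refine SemidirectProduct.ext (Multiplicative.toAdd.injective ?_)
    (hφ (congrArg SemidirectProduct.right h))
  have h' := congrArg (fun r => r.left.toAdd) h
  simp only [wreathMap_left] at h'
  exact Finsupp.mapRange_injective f f.map_zero hf (Finsupp.mapDomain_injective hφ h')

end WreathMap

theorem HasFiniteStateRep.of_injective {G H : Type*} [Group G] [Group H]
    (hH : HasFiniteStateRep H) (f : G →* H) (hf : Function.Injective f) :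
    HasFiniteStateRep G := by
  obtain ⟨m, hm, φ, hφ, h⟩ := hH
  exact ⟨m, hm, φ.comp f, hφ.comp hf, fun g => h (f g)⟩

theorem HasSelfSimilarFiniteStateRep.hasFiniteStateRep {G : Type*} [Group G]
    (h : HasSelfSimilarFiniteStateRep G) : HasFiniteStateRep G := by
  obtain ⟨m, hm, φ, hφ, -, hfin⟩ := h
  exact ⟨m, hm, φ, hφ, hfin⟩

theorem hasFiniteStateRep_of_subsingleton (G : Type*) [Group G] [Subsingleton G] :
    HasFiniteStateRep G := by
  refine ⟨2, le_rfl, 1, Function.injective_of_subsingleton _, fun g => ?_⟩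
  refine (Set.finite_singleton (1 : TreeAut (Fin 2))).subset ?_
  rintro _ ⟨u, rfl⟩
  refine Subtype.ext (Equiv.ext fun w => ?_)
  exact List.drop_left

/-- The wreath product of an abelian group with a faithful self-similar finite-state action by a
finite-state group is finite-state. -/
theorem HasFiniteStateRep.wreath_of_selfSimilarAction {A G Z : Type*} [AddCommGroup A] [Group G]
    [Finite Z] (T : SelfSimilarAction (Multiplicative A) Z) (hT : ∀ a, a ∈ T.finiteState)
    (hT' : ∀ a, (∀ w, T.word a w = w) → a = 1) (hG : HasFiniteStateRep G) :
    HasFiniteStateRep (Wreath A G) := by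
  classical
  obtain ⟨m, hm, φ, hφ, hfin⟩ := hG
  let R := TreeAut.selfSimilarAction (Fin m)
  let S := R.restart
  let δ : G →* TreeAut (Fin m) × TreeAut (Fin m) := φ.prod φ
  have hR : ∀ g, φ g ∈ R.finiteState := fun g => by
    rw [SelfSimilarAction.mem_finiteState]
    exact (hfin g).subset (by
      rintro _ ⟨u, rfl⟩
      exact ⟨u, (TreeAut.secs_selfSimilarAction (φ g) u).symm⟩)
  have hδ : ∀ g, δ g ∈ S.finiteState := fun g => R.restart_mem_finiteState (hR g)
  have hmove : ∀ g, g ≠ 1 → ∃ w, R.word (φ g) w ≠ w := by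
    intro g hg
    by_contra! h
    refine hg (hφ ?_)
    rw [map_one]
    refine Subtype.ext (Equiv.ext fun w => ?_)
    rw [← TreeAut.word_selfSimilarAction]
    exact h w
  have hinj : Function.Injective (wreathMap (AddMonoidHom.id A) δ) :=
    wreathMap_injective Function.injective_id fun g h hgh => hφ (congrArg Prod.fst hgh)
  have hsupp : ∀ q : Wreath A G, (wreathMap (AddMonoidHom.id A) δ q).left.toAdd.support ⊆
      q.left.toAdd.support.image δ := fun q => by
    rw [wreathMap_left]
    exact Finsupp.mapDomain_support.trans (Finset.image_subset_image Finsupp.support_mapRange)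
  have : Nontrivial ((Option (Fin m) × Option (Fin m)) ⊕ Z) :=
    ⟨.inl (none, none), .inl (none, some ⟨0, by omega⟩), by simp⟩
  refine (S.wreath T).hasFiniteStateRep (wreathMap (AddMonoidHom.id A) δ) (fun q => ?_)
    fun q hq => hinj ?_
  · refine S.wreath_mem_finiteState T (hδ _) (fun h hh => ?_) hT
    obtain ⟨g, -, rfl⟩ := Finset.mem_image.1 (hsupp q hh)
    exact hδ g
  · rw [map_one]
    refine S.wreath_faithful T hT' (fun hw => ?_) ?_ hq
    · rw [wreathMap_right] at hw ⊢
      by_contra hne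
      obtain ⟨w, hw'⟩ := hmove q.right fun h => hne (by rw [h, map_one])
      have h := hw (w.map some)
      rw [R.word_restart_map_some] at h
      exact hw' (List.map_injective_iff.2 (Option.some_injective _) h)
    · obtain ⟨v, hv⟩ := R.exists_restart_word_ne
        (q.left.toAdd.support.offDiag.image fun p => φ (p.1⁻¹ * p.2)) (by
          intro g hg
          obtain ⟨p, hp, rfl⟩ := Finset.mem_image.1 hg
          refine hmove _ fun h => (Finset.mem_offDiag.1 hp).2.2 ?_
          rwa [inv_mul_eq_one] at h)
      refine ⟨v, fun h hh k hk hhk => ?_⟩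
      obtain ⟨a, ha, rfl⟩ := Finset.mem_image.1 (hsupp q hh)
      obtain ⟨b, hb, rfl⟩ := Finset.mem_image.1 (hsupp q hk)
      by_contra hne
      refine hv (φ (a⁻¹ * b)) (Finset.mem_image.2 ⟨(a, b), Finset.mem_offDiag.2
        ⟨ha, hb, fun h => hne (congrArg δ h)⟩, rfl⟩) ?_
      have e : (φ (a⁻¹ * b), φ (a⁻¹ * b)) = (δ a)⁻¹ * δ b := by
        rw [← map_inv, ← map_mul]
        rfl
      change S.word _ v = v
      rw [e, S.word_mul, ← show S.word (δ a) v = S.word (δ b) v from hhk, S.word_inv_word]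

/-- The wreath product of a finitely generated abelian group by a finite-state group is
finite-state. -/
theorem HasFiniteStateRep.wreath {G : Type*} [Group G] (hG : HasFiniteStateRep G)
    (A : Type*) [AddCommGroup A] (hA : AddGroup.FG A) : HasFiniteStateRep (Wreath A G) := by
  obtain ⟨n, B, _, _, f, hf⟩ := AddCommGroup.exists_injective_int_pow_prod_finite A
  have h : HasFiniteStateRep (Wreath ((Fin n → ℤ) × B) G) :=
    hG.wreath_of_selfSimilarAction (odometer (Fin n) B) (mem_finiteState_odometer (Fin n) B)
      (odometer_faithful (Fin n) B)
  exact h.of_injective (wreathMap f (MonoidHom.id G))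
    (wreathMap_injective hf Function.injective_id)

/-- `ℤ` is the base group of `ℤ ≀ 1`, so the wreath product result also starts the induction. -/
theorem hasFiniteStateRep_multiplicative_int : HasFiniteStateRep (Multiplicative ℤ) := by
  have h := (hasFiniteStateRep_of_subsingleton Unit).wreath ℤ inferInstance
  refine h.of_injective (SemidirectProduct.inl.comp
    (AddMonoidHom.toMultiplicative (Finsupp.singleAddHom ()))) ?_
  exact SemidirectProduct.inl_injective.comp (Finsupp.single_injective (M := ℤ) ())

theorem hasFiniteStateRep_iterWreath (k : ℕ) : HasFiniteStateRep (iterWreath (k + 1)) := by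
  induction k with
  | zero => exact hasFiniteStateRep_multiplicative_int
  | succ k ih => exact ih.wreath ℤ inferInstance

theorem theoremC :
    (∀ (A : Type*) (G : Type*) [AddCommGroup A] [Group G],
      AddGroup.FG A → HasSelfSimilarFiniteStateRep G → (∃ x : G, ¬ IsOfFinOrder x) →
        HasFiniteStateRep (Wreath A G)) ∧
    (∀ (G : Type*) [Group G],
      HasSelfSimilarFiniteStateRep G → HasFiniteStateRep (Wreath ℤ G)) ∧
    (∀ k : ℕ, 1 ≤ k → HasFiniteStateRep (iterWreath k)) ∧
    HasFiniteStateRep (Wreath (ZMod 2) (Wreath ℤ (Multiplicative ℤ))) := by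
  refine ⟨fun A G _ _ hA hG _ => hG.hasFiniteStateRep.wreath A hA,
    fun G _ hG => hG.hasFiniteStateRep.wreath ℤ inferInstance, fun k hk => ?_, ?_⟩
  · obtain ⟨k, rfl⟩ := Nat.exists_eq_add_of_le' hk
    exact hasFiniteStateRep_iterWreath k
  · exact (hasFiniteStateRep_multiplicative_int.wreath ℤ inferInstance).wreath (ZMod 2)
      inferInstance
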